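/- Let $V$ be the ground model and let $\mathbb P_1\in V$ be the set of all partial functions $f$ from $\mathbb N$ to $2=\{0,1\}$ with $\limsup_n |[2^n,2^{n+1})\setminus \mathrm{dom}(f)|=\infty$, ordered by $f<g$ iff $g\subset^* f$ (that is, $f$ extends $g$ except at finitely many points of $\mathrm{dom}(g)$). Let $H$ be $V$-generic for $\omega_2^{<\omega_1}$, the set of functions from countable ordinals into $\omega_2$, ordered by end-extension. In $V[H]$, let $\mathfrak F=\langle f_\xi:\xi<\mu\rangle$ be a sequence of members of $\mathbb P_1$, descending in this order (if $\xi<\eta$ then $f_\xi\subset^* f_\eta$), which is $\mathbb P_1$-generic over $V$: for each dense $D\subset\mathbb P_1$ with $D\in V$, some $f_\xi$ belongs to $D$. Let $\mathbb P(\mathfrak F)$ be the set of all $g\in\mathbb P_1$ with $g=^*f_\xi$ for some $\xi<\mu$, ordered by $\supseteq$, and assume that $\mathbb P(\mathfrak F)$ is ccc in $V[H]$. Let $\dot h\in V[H]$ be a $\mathbb P(\mathfrak F)$-name for a function from $\mathbb N$ to $\mathbb N$. Then at least one of the following holds: 1. there is $f\in\mathfrak F$ such that $f\Vdash_{\mathbb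 P(\mathfrak F)}\dot h\restriction \mathrm{dom}(f)\notin V$; 2. there are $f\in\mathfrak F$, an increasing sequence $m_1<m_2<\cdots$ of natural numbers and sets $S_k\subset[2^{m_k},2^{m_{k+1}})$ ($k\ge 1$), with $\langle m_k\rangle_k$ and $\langle S_k\rangle_k$ in $V$, such that $\mathbb N\setminus\mathrm{dom}(f)=\bigcup_k S_k$, and for each $k$ and each $i\in S_k$ the condition $f\cup\{(i,0)\}$ of $\mathbb P(\mathfrak F)$ forces a value on $\dot h(i)$, that is, there is $j\in\mathbb N$ with $f\cup\{(i,0)\}\Vdash_{\mathbb P(\mathfrak F)}\dot h(i)=j$. -/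

import Mathlib

open Set Filter

universe u v w

namespace TieForcing



/-! ### Forcing over the ground model

The ground model `V` is the ambient universe.  For a preordered set `C` of conditions (smaller is
stronger), the objects of `V[H]` that are subsets of a ground model set `X` are given by names, and
truth in `V[H]` is given by the forcing relation, defined by the usual recursion on sentences. -/

/-- A `C`-name for a subset of the ground model set `X`: a set of pairs `(x̌, p)`. Every subset
of `X` in the extension is the value of a name of this form. -/
def Name (C : Type u) (X : Type v) : Type (max u v) := Set (X × C)

/-- A sentence of the forcing language, given by the conditions that force it. -/
def Sentence (C : Type u) : Type u := C → Prop

/-- `p ⊩ φ`: the condition `p` forces the sentence `φ`. -/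
def Forces {C : Type u} (p : C) (φ : Sentence C) : Prop := φ p

infix:26 " ⊩ " => Forces

/-- `D` is dense below `p`. -/
def DenseBelow {C : Type u} [Preorder C] (D : Set C) (p : C) : Prop :=
  ∀ q ≤ p, ∃ r ≤ q, r ∈ D

namespace Sentence

/-- `x̌ ∈ A`, for `x` in the ground model. -/
def mem {C : Type u} {X : Type v} [Preorder C] (x : X) (A : Name C X) : Sentence C :=
  fun p => DenseBelow {q | ∃ r, (x, r) ∈ (show Set (X × C) from A) ∧ q ≤ r} p

/-- A statement about the ground model (absolute between `V` and the extension). -/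
def ground {C : Type u} (P : Prop) : Sentence C := fun _ => P

def and {C : Type u} (φ ψ : Sentence C) : Sentence C := fun p => φ p ∧ ψ p

def imp {C : Type u} [Preorder C] (φ ψ : Sentence C) : Sentence C :=
  fun p => ∀ q ≤ p, φ q → ψ q

def not {C : Type u} [Preorder C] (φ : Sentence C) : Sentence C :=
  fun p => ∀ q ≤ p, ¬ φ q

def or {C : Type u} [Preorder C] (φ ψ : Sentence C) : Sentence C :=
  fun p => DenseBelow {q | φ q ∨ ψ q} p

/-- Universal quantifier. With `ι` a ground model set it ranges over the elements of that set; with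
`ι` a type of names it ranges over all subsets in the extension of a ground model set. -/
def all {C : Type u} {ι : Sort w} (φ : ι → Sentence C) : Sentence C := fun p => ∀ x, φ x p

/-- Existential quantifier, with the same ranges as `all`. -/
def ex {C : Type u} {ι : Sort w} [Preorder C] (φ : ι → Sentence C) : Sentence C :=
  fun p => DenseBelow {q | ∃ x, φ x q} p

end Sentence

infixr:35 " ⋏ " => Sentence.and
infixr:30 " ⋎ " => Sentence.or
infixr:28 " ⟹ " => Sentence.imp

/-! ### The collapse `ω₂^{<ω₁}` -/

/-- Conditions of `ω₂^{<ω₁}`: functions from a countable ordinal into `ω₂`. -/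
structure Collapse where
  len : Ordinal.{0}
  len_lt : len < Ordinal.omega 1
  val : Set.Iio len → Set.Iio (Ordinal.omega.{0} 2)

/-- A condition is stronger if it is a longer function. -/
instance : Preorder Collapse where
  le q p := ∃ h : p.len ≤ q.len, ∀ ξ : Set.Iio p.len, q.val ⟨ξ.1, lt_of_lt_of_le ξ.2 h⟩ = p.val ξ
  le_refl p := ⟨le_refl _, fun _ => rfl⟩
  le_trans a b c := by
    rintro ⟨h, hab⟩ ⟨h', hbc⟩
    exact ⟨h'.trans h, fun ξ => (hab ⟨ξ.1, lt_of_lt_of_le ξ.2 h'⟩).trans (hbc ξ)⟩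

/-! ### The poset `ℙ₁` -/

/-- The domain of a partial function. -/
def pdom (f : ℕ → Option (Fin 2)) : Set ℕ := {i | f i ≠ none}

/-- Conditions of `ℙ₁`: partial functions `f` from `ℕ` into `2` with
`limsup_n |[2^n, 2^(n+1)) \ dom f| = ∞`. -/
structure P1 where
  val : ℕ → Option (Fin 2)
  growth : limsup (fun n : ℕ => (Set.Ico (2 ^ n) (2 ^ (n + 1)) \ pdom val).encard) atTop = ⊤

namespace P1

def dom (f : P1) : Set ℕ := pdom f.val

/-- `f ⊆ g` -/
def Sub (f g : P1) : Prop := ∀ i ∈ f.dom, g.val i = f.val i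

/-- `f ⊆* g`, that is, `g` is below `f` in the ordering of `ℙ₁`. -/
def AlmostSub (f g : P1) : Prop := {i | i ∈ f.dom ∧ g.val i ≠ f.val i}.Finite

/-- `f =* g` -/
def AlmostEq (f g : P1) : Prop := {i | f.val i ≠ g.val i}.Finite

/-- `D` is a dense subset of `ℙ₁` (in the ordering mod finite). -/
def IsDense (D : Set P1) : Prop := ∀ f : P1, ∃ g ∈ D, AlmostSub f g

/-- `f ∪ {(i, b)}`, for `i ∉ dom f`. -/
def insert (f : P1) (i : ℕ) (b : Fin 2) : P1 where
  val := Function.update f.val i (some b)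
  growth := by
    rw [← f.growth]
    apply limsup_congr
    filter_upwards [eventually_gt_atTop i] with n hn
    congr 1
    ext j
    have key : 2 ^ n ≤ j → j ≠ i := fun h e => by
      have : n < 2 ^ n := Nat.lt_two_pow_self
      omega
    simp only [Set.mem_sdiff, Set.mem_Ico, pdom, Set.mem_ofPred_eq]
    constructor
    · rintro ⟨h, h'⟩
      exact ⟨h, by rwa [Function.update_of_ne (key h.1)] at h'⟩
    · rintro ⟨h, h'⟩
      exact ⟨h, by rwa [Function.update_of_ne (key h.1)]⟩

end P1

/-! ### The sequence `𝔉` and the poset `ℙ(𝔉)` in the extension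

From here on `F` is a name for (the graph of) a sequence `𝔉 = ⟨f_ξ : ξ < μ⟩` of members of `ℙ₁`. -/

open Sentence

/-- `f ∈ 𝔉`. -/
def inF {C : Type u} [Preorder C] {μ : Ordinal.{v}} (F : Name C (Set.Iio μ × P1)) (f : P1) :
    Sentence C :=
  ex fun ξ : Set.Iio μ => mem (ξ, f) F

/-- `𝔉` is a function from `μ` to `ℙ₁`, descending in the ordering of `ℙ₁`. -/
def isDescendingSeq {C : Type u} [Preorder C] {μ : Ordinal.{v}} (F : Name C (Set.Iio μ × P1)) :
    Sentence C :=
  (all fun ξ : Set.Iio μ => ex fun f : P1 => mem (ξ, f) F) ⋏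
  (all fun ξ : Set.Iio μ => all fun f : P1 => all fun g : P1 =>
    mem (ξ, f) F ⋏ mem (ξ, g) F ⟹ ground (f = g)) ⋏
  (all fun ξ : Set.Iio μ => all fun η : Set.Iio μ => all fun f : P1 => all fun g : P1 =>
    ground (ξ < η) ⋏ mem (ξ, f) F ⋏ mem (η, g) F ⟹ ground (P1.AlmostSub f g))

/-- `𝔉` is generic over `V`: it meets every dense subset of `ℙ₁` lying in `V`. -/
def isGenericOverGround {C : Type u} [Preorder C] {μ : Ordinal.{v}}
    (F : Name C (Set.Iio μ × P1)) : Sentence C :=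
  all fun D : Set P1 => ground (P1.IsDense D) ⟹ ex fun f : P1 => ground (f ∈ D) ⋏ inF F f

/-- `g ∈ ℙ(𝔉)`: `g` is a member of `ℙ₁` with `g =* f` for some `f ∈ 𝔉`. -/
def inPF {C : Type u} [Preorder C] {μ : Ordinal.{v}} (F : Name C (Set.Iio μ × P1)) (g : P1) :
    Sentence C :=
  ex fun f : P1 => inF F f ⋏ ground (P1.AlmostEq g f)

/-- `r ∈ ℙ(𝔉)` and `r` extends `q` in the ordering `⊇` of `ℙ(𝔉)`. -/
def extPF {C : Type u} [Preorder C] {μ : Ordinal.{v}} (F : Name C (Set.Iio μ × P1)) (r q : P1) :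
    Sentence C :=
  inPF F r ⋏ ground (P1.Sub q r)

/-- `ℙ(𝔉)` is ccc (in the extension): every antichain `A ⊆ ℙ(𝔉)` is covered by the range of a
partial function with domain contained in `ℕ`. -/
def isCCC {C : Type u} [Preorder C] {μ : Ordinal.{v}} (F : Name C (Set.Iio μ × P1)) :
    Sentence C :=
  all fun A : Name C P1 =>
    (all fun g : P1 => mem g A ⟹ inPF F g) ⋏
    (all fun g : P1 => all fun g' : P1 => mem g A ⋏ mem g' A ⋏ ground (g ≠ g') ⟹
      Sentence.not (ex fun r : P1 => extPF F r g ⋏ extPF F r g')) ⟹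
    ex fun e : Name C (ℕ × P1) =>
      (all fun n : ℕ => all fun g : P1 => all fun g' : P1 =>
        mem (n, g) e ⋏ mem (n, g') e ⟹ ground (g = g')) ⋏
      (all fun g : P1 => mem g A ⟹ ex fun n : ℕ => mem (n, g) e)

/-! ### `ℙ(𝔉)`-names in the extension

`h` is a name for a `ℙ(𝔉)`-name `ḣ` for a subset of `ℕ × ℕ`: a set of pairs `((i, j)ˇ, a)`
with `a ∈ ℙ(𝔉)`, here written as triples `(i, j, a)`. -/

/-- `q ⊩_{ℙ(𝔉)} ḣ(i) = j`, that is, `q ⊩_{ℙ(𝔉)} (i, j) ∈ ḣ`: densely many extensions of `q` in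
`ℙ(𝔉)` extend some `a` with `(i, j, a) ∈ ḣ`. -/
def forcesValue {C : Type u} [Preorder C] {μ : Ordinal.{v}} (F : Name C (Set.Iio μ × P1))
    (h : Name C (ℕ × ℕ × P1)) (q : P1) (i j : ℕ) : Sentence C :=
  all fun r : P1 => extPF F r q ⟹
    ex fun s : P1 => extPF F s r ⋏ ex fun a : P1 => mem (i, j, a) h ⋏ ground (P1.Sub a s)

/-- `ḣ` is a `ℙ(𝔉)`-name, and every condition of `ℙ(𝔉)` forces that it is a function from `ℕ`
to `ℕ`. -/
def isFunctionName {C : Type u} [Preorder C] {μ : Ordinal.{v}} (F : Name C (Set.Iio μ × P1))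
    (h : Name C (ℕ × ℕ × P1)) : Sentence C :=
  (all fun i : ℕ => all fun j : ℕ => all fun a : P1 => mem (i, j, a) h ⟹ inPF F a) ⋏
  (all fun i : ℕ => all fun q : P1 => inPF F q ⟹
    ex fun r : P1 => extPF F r q ⋏ ex fun j : ℕ => forcesValue F h r i j) ⋏
  (all fun i : ℕ => all fun j : ℕ => all fun j' : ℕ => all fun q : P1 =>
    inPF F q ⋏ forcesValue F h q i j ⋏ forcesValue F h q i j' ⟹ ground (j = j'))

/-- `f ⊩_{ℙ(𝔉)} ḣ ↾ dom f ∉ V`: for no function `e` in `V` is there an extension of `f` in `ℙ(𝔉)`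
forcing that `ḣ` agrees with `e` on `dom f`. -/
def forcesRestrictionNew {C : Type u} [Preorder C] {μ : Ordinal.{v}}
    (F : Name C (Set.Iio μ × P1)) (h : Name C (ℕ × ℕ × P1)) (f : P1) : Sentence C :=
  all fun e : ℕ → ℕ => all fun r : P1 => extPF F r f ⟹
    Sentence.not (all fun i : ℕ => ground (i ∈ f.dom) ⟹ forcesValue F h r i (e i))

/-- `ℕ \ dom f = ⋃ₖ Sₖ` with `Sₖ ⊆ [2^(mₖ), 2^(mₖ₊₁))` and `m₀ < m₁ < ⋯`, and for each `i ∈ Sₖ` the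
condition `f ∪ {(i, 0)}` forces a value on `ḣ(i)`. -/
def decidesOnPieces {C : Type u} [Preorder C] {μ : Ordinal.{v}}
    (F : Name C (Set.Iio μ × P1)) (h : Name C (ℕ × ℕ × P1)) (f : P1)
    (m : ℕ → ℕ) (S : ℕ → Set ℕ) : Sentence C :=
  ground (StrictMono m) ⋏
  ground (f.domᶜ = ⋃ k, S k) ⋏
  ground (∀ k, S k ⊆ Set.Ico (2 ^ m k) (2 ^ m (k + 1))) ⋏
  (all fun k : ℕ => all fun i : ℕ => ground (i ∈ S k) ⟹
    ex fun j : ℕ => forcesValue F h (f.insert i 0) i j)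

end TieForcing

open TieForcing

namespace TieForcing

/-! The alternatives are settled in the ground model, by a density argument in `P1`. Countable
closure of the collapse and ccc give, below some condition, ground model sets `A i j` of conditions
forcing ḣ(i) = j such that, for each i, the union over j is predense in ℙ(𝔉)
(`exists_ground_reading`). Deciding ḣ(i) thus becomes a ground model relation `Dec`. By fusion
(`exists_continuous_reading`), a condition below which everything can be decided extends to some g
with a continuous H: filling g below `N i` with the values of x decides ḣ(i) as `H x i`.

The core is combinatorial (`Positive.exists_mimic`). The complement of dom g is thinned to a
positive U' so that each i ∈ U' is mimicked by some i' ∉ U': among the points x that agree off U'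
with a fixed y and have x i = 0, the value `H x i'` determines `H x i`. Let f be y restricted to the
complement of U'. If no extension of f fixes H on dom f, then genericity of 𝔉 makes ḣ ↾ dom f differ
from every ground model function. Otherwise some r ⊇ f fixes H on dom f, hence at all the mimics i',
hence r ∪ {(i, 0)} fixes the value at i for each i ∉ dom r. Such conditions, together with those
that cannot decide some coordinate, form a dense set in V, which 𝔉 meets; predensity excludes the
undecidable ones. -/

/-! ### Positive sets and conditions of `ℙ₁` -/

/-- The dyadic block `[2^n, 2^(n+1))`. -/
abbrev block (n : ℕ) : Set ℕ := Set.Ico (2 ^ n) (2 ^ (n + 1))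

/-- `U` meets the dyadic blocks in sets of unbounded size. -/
def Positive (U : Set ℕ) : Prop := ∀ m N : ℕ, ∃ n ≥ N, (m : ℕ∞) ≤ (block n ∩ U).encard

theorem limsup_eq_top_iff (a : ℕ → ℕ∞) :
    limsup a atTop = ⊤ ↔ ∀ m N : ℕ, ∃ n ≥ N, (m : ℕ∞) ≤ a n := by
  constructor
  · intro h m N
    have hm : (m : ℕ∞) < limsup a atTop := by rw [h]; exact ENat.natCast_lt_top m
    obtain ⟨n, hn, hlt⟩ := (frequently_atTop.1 (frequently_lt_of_lt_limsup (by isBoundedDefault) hm)) N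
    exact ⟨n, hn, hlt.le⟩
  · intro h
    refine ENat.eq_top_iff_forall_ge.2 fun m => ?_
    exact le_limsup_of_frequently_le (frequently_atTop.2 fun N => h m N) (by isBoundedDefault)

theorem growth_iff_positive (a : ℕ → Option (Fin 2)) :
    limsup (fun n : ℕ => (Set.Ico (2 ^ n) (2 ^ (n + 1)) \ pdom a).encard) atTop = ⊤ ↔
      Positive (pdom a)ᶜ := by
  rw [limsup_eq_top_iff]; rfl

theorem le_of_mem_block {n j : ℕ} (h : j ∈ block n) : n ≤ j :=
  (Nat.lt_two_pow_self (n := n)).le.trans h.1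

theorem Positive.of_agree {U U' : Set ℕ} (hU : Positive U) (M : ℕ)
    (h : ∀ j, M ≤ j → j ∈ U → j ∈ U') : Positive U' := by
  intro m N
  obtain ⟨n, hn, hm⟩ := hU m (max M N)
  refine ⟨n, le_trans (le_max_right _ _) hn, hm.trans (Set.encard_le_encard ?_)⟩
  rintro j ⟨hj, hjU⟩
  exact ⟨hj, h j ((le_max_left _ _).trans (hn.trans (le_of_mem_block hj))) hjU⟩

namespace P1

theorem positive (f : P1) : Positive f.domᶜ := (growth_iff_positive f.val).1 f.growth

theorem mem_dom {f : P1} {i : ℕ} : i ∈ f.dom ↔ f.val i ≠ none := Iff.rfl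

theorem not_mem_dom {f : P1} {i : ℕ} : i ∉ f.dom ↔ f.val i = none := by
  rw [mem_dom, not_not]

theorem Sub.refl (f : P1) : f.Sub f := fun _ _ => rfl

theorem Sub.dom_subset {f g : P1} (h : f.Sub g) : f.dom ⊆ g.dom := fun i hi => by
  rw [mem_dom, h i hi]; exact hi

theorem Sub.trans {f g k : P1} (h : f.Sub g) (h' : g.Sub k) : f.Sub k := fun i hi =>
  (h' i (h.dom_subset hi)).trans (h i hi)

theorem Sub.almostSub {f g : P1} (h : f.Sub g) : AlmostSub f g := by
  refine Set.finite_empty.subset ?_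
  rintro i ⟨hi, hne⟩
  exact hne (h i hi)

theorem almostSub_iff {f g : P1} :
    AlmostSub f g ↔ ∃ M, ∀ i, M ≤ i → i ∈ f.dom → g.val i = f.val i := by
  constructor
  · intro h
    obtain ⟨M, hM⟩ := Set.Finite.bddAbove h
    refine ⟨M + 1, fun i hi hif => ?_⟩
    by_contra hne
    exact absurd (hM (show i ∈ {i | i ∈ f.dom ∧ g.val i ≠ f.val i} from ⟨hif, hne⟩)) (by omega)
  · rintro ⟨M, hM⟩
    refine (Set.finite_lt_nat M).subset ?_
    rintro i ⟨hi, hne⟩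
    by_contra hlt
    exact hne (hM i (not_lt.1 hlt) hi)

theorem almostEq_iff {f g : P1} : AlmostEq f g ↔ ∃ M, ∀ i, M ≤ i → f.val i = g.val i := by
  constructor
  · intro h
    obtain ⟨M, hM⟩ := Set.Finite.bddAbove h
    refine ⟨M + 1, fun i hi => ?_⟩
    by_contra hne
    exact absurd (hM (show i ∈ {i | f.val i ≠ g.val i} from hne)) (by omega)
  · rintro ⟨M, hM⟩
    refine (Set.finite_lt_nat M).subset ?_
    intro i hne
    by_contra hlt
    exact hne (hM i (not_lt.1 hlt))

theorem AlmostEq.refl (f : P1) : AlmostEq f f := almostEq_iff.2 ⟨0, fun _ _ => rfl⟩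

theorem AlmostEq.symm {f g : P1} (h : AlmostEq f g) : AlmostEq g f := by
  obtain ⟨M, hM⟩ := almostEq_iff.1 h
  exact almostEq_iff.2 ⟨M, fun i hi => (hM i hi).symm⟩

theorem AlmostEq.trans {f g k : P1} (h : AlmostEq f g) (h' : AlmostEq g k) : AlmostEq f k := by
  obtain ⟨M, hM⟩ := almostEq_iff.1 h
  obtain ⟨M', hM'⟩ := almostEq_iff.1 h'
  exact almostEq_iff.2 ⟨max M M', fun i hi =>
    (hM i ((le_max_left _ _).trans hi)).trans (hM' i ((le_max_right _ _).trans hi))⟩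

theorem AlmostEq.almostSub {f g : P1} (h : AlmostEq f g) : AlmostSub f g := by
  obtain ⟨M, hM⟩ := almostEq_iff.1 h
  exact almostSub_iff.2 ⟨M, fun i hi _ => (hM i hi).symm⟩

theorem AlmostSub.trans {f g k : P1} (h : AlmostSub f g) (h' : AlmostSub g k) :
    AlmostSub f k := by
  obtain ⟨M, hM⟩ := almostSub_iff.1 h
  obtain ⟨M', hM'⟩ := almostSub_iff.1 h'
  refine almostSub_iff.2 ⟨max M M', fun i hi hif => ?_⟩
  have e := hM i ((le_max_left _ _).trans hi) hif
  have hig : i ∈ g.dom := by rw [mem_dom, e]; exact hif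
  exact (hM' i ((le_max_right _ _).trans hi) hig).trans e

/-- `f` with its values below `M` replaced by those of `a`. -/
def splice (M : ℕ) (a : ℕ → Option (Fin 2)) (f : P1) : P1 where
  val := fun j => if j < M then a j else f.val j
  growth := by
    rw [growth_iff_positive]
    refine f.positive.of_agree M fun j hj hjf => ?_
    have : ¬ j < M := not_lt.2 hj
    simpa [pdom, this] using not_mem_dom.1 hjf

theorem splice_of_lt {M j : ℕ} (h : j < M) (a : ℕ → Option (Fin 2)) (f : P1) :
    (splice M a f).val j = a j := if_pos h

theorem splice_of_le {M j : ℕ} (h : M ≤ j) (a : ℕ → Option (Fin 2)) (f : P1) :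
    (splice M a f).val j = f.val j := if_neg (not_lt.2 h)

theorem almostEq_splice (M : ℕ) (a : ℕ → Option (Fin 2)) (f : P1) : AlmostEq (splice M a f) f :=
  almostEq_iff.2 ⟨M, fun _ hj => splice_of_le hj a f⟩

/-- If `f ⊆* g` then some finite modification of `g` extends `f`. -/
theorem AlmostSub.exists_sub {f g : P1} (h : AlmostSub f g) : ∃ g', AlmostEq g' g ∧ f.Sub g' := by
  obtain ⟨M, hM⟩ := almostSub_iff.1 h
  refine ⟨splice M f.val g, almostEq_splice _ _ _, fun i hi => ?_⟩
  rcases lt_or_ge i M with hlt | hge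
  · exact splice_of_lt hlt _ _
  · exact (splice_of_le hge _ _).trans (hM i hge hi)

/-- `f` filled in below `M`, with the values of `x`. -/
def fill (M : ℕ) (x : ℕ → Fin 2) (f : P1) : P1 := splice M (fun j => some (x j)) f

theorem fill_of_lt {M j : ℕ} (h : j < M) (x : ℕ → Fin 2) (f : P1) :
    (fill M x f).val j = some (x j) := splice_of_lt h _ _

theorem fill_of_le {M j : ℕ} (h : M ≤ j) (x : ℕ → Fin 2) (f : P1) :
    (fill M x f).val j = f.val j := splice_of_le h _ _

theorem fill_congr {M : ℕ} {x x' : ℕ → Fin 2} (h : ∀ j < M, x j = x' j) (f : P1) :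
    fill M x f = fill M x' f := by
  unfold fill splice
  congr 1
  funext j
  split_ifs with hj
  · exact congrArg some (h j hj)
  · rfl

theorem Sub.fill_mono {f g : P1} (h : f.Sub g) (M : ℕ) (x : ℕ → Fin 2) :
    (fill M x f).Sub (fill M x g) := by
  intro j hj
  rcases lt_or_ge j M with hlt | hge
  · rw [fill_of_lt hlt, fill_of_lt hlt]
  · rw [fill_of_le hge, fill_of_le hge]
    rw [mem_dom, fill_of_le hge] at hj
    exact h j hj

/-- The total function `x` extends `f`. -/
def Extends (x : ℕ → Fin 2) (f : P1) : Prop := ∀ i ∈ f.dom, f.val i = some (x i)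

theorem Extends.mono {x : ℕ → Fin 2} {f g : P1} (h : Extends x g) (hfg : f.Sub g) :
    Extends x f := fun i hi => (hfg i hi).symm.trans (h i (hfg.dom_subset hi))

theorem Extends.sub_fill {x : ℕ → Fin 2} {f : P1} (h : Extends x f) (M : ℕ) :
    f.Sub (fill M x f) := by
  intro j hj
  rcases lt_or_ge j M with hlt | hge
  · rw [fill_of_lt hlt, h j hj]
  · rw [fill_of_le hge]

theorem exists_extends (f : P1) : ∃ x, Extends x f := by
  refine ⟨fun i => (f.val i).getD 0, fun i hi => ?_⟩
  obtain ⟨b, hb⟩ := Option.ne_none_iff_exists'.1 (mem_dom.1 hi)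
  simp [hb]

/-! ### Fusion in ℙ₁ and continuous reading. -/

/-- Fusion: requirements `R M`, preserved by extensions, can be met without changing a condition
below `M`; then one extension meets them for unboundedly many `M`. -/
theorem exists_fusion (R : ℕ → P1 → Prop) (hmono : ∀ M f g, f.Sub g → R M f → R M g) (f₀ : P1)
    (step : ∀ M f, f₀.Sub f → ∃ g : P1, f.Sub g ∧ (∀ j < M, g.val j = f.val j) ∧ R M g) :
    ∃ g, f₀.Sub g ∧ ∃ M : ℕ → ℕ, StrictMono M ∧ ∀ k, R (M k) g := by
  -- The new bound 2^(n+1) freezes a whole block with at least k undefined points, which keeps the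
  -- limit in ℙ₁.
  have next : ∀ (k : ℕ) (s : {f : P1 // f₀.Sub f} × ℕ), ∃ t : {f : P1 // f₀.Sub f} × ℕ,
      s.1.1.Sub t.1.1 ∧ (∀ j < s.2, t.1.1.val j = s.1.1.val j) ∧ R s.2 t.1.1 ∧ s.2 < t.2 ∧
      ∃ n ≥ s.2, 2 ^ (n + 1) = t.2 ∧ (k : ℕ∞) ≤ (block n ∩ t.1.1.domᶜ).encard := by
    rintro k ⟨⟨f, hf⟩, M⟩
    obtain ⟨g, hfg, hlow, hR⟩ := step M f hf
    obtain ⟨n, hn, hk⟩ := g.positive k M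
    have : n + 1 < 2 ^ (n + 1) := Nat.lt_two_pow_self
    exact ⟨⟨⟨g, hf.trans hfg⟩, 2 ^ (n + 1)⟩, hfg, hlow, hR, show M < _ by omega, n, hn, rfl, hk⟩
  choose nx h1 h2 h3 h4 h5 using next
  let s : ℕ → {f : P1 // f₀.Sub f} × ℕ := fun k => Nat.rec (⟨f₀, Sub.refl _⟩, 0) (fun k t => nx k t) k
  have hs : ∀ k, s (k + 1) = nx k (s k) := fun k => rfl
  have hM : StrictMono fun k => (s k).2 := strictMono_nat_of_lt_succ fun k => h4 k (s k)
  have hsub : ∀ k l, k ≤ l → (s k).1.1.Sub (s l).1.1 := by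
    intro k l hkl
    induction l, hkl using Nat.le_induction with
    | base => exact Sub.refl _
    | succ l _ ih => exact ih.trans (h1 l (s l))
  have hstable : ∀ k l, k ≤ l → ∀ j < (s k).2, (s l).1.1.val j = (s k).1.1.val j := by
    intro k l hkl
    induction l, hkl using Nat.le_induction with
    | base => exact fun _ _ => rfl
    | succ l hl ih =>
      intro j hj
      exact (h2 l (s l) j (hj.trans_le (hM.monotone hl))).trans (ih j hj)
  have hid : ∀ k, k ≤ (s k).2 := fun k => hM.le_apply
  -- The bound at stage j + 1 exceeds j, so the value at j is final from that stage on.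
  let a : ℕ → Option (Fin 2) := fun j => (s (j + 1)).1.1.val j
  have ha : ∀ k, ∀ j < (s k).2, a j = (s k).1.1.val j := by
    intro k j hj
    rcases le_total k (j + 1) with h | h
    · exact hstable k (j + 1) h j hj
    · exact (hstable (j + 1) k h j (hid (j + 1))).symm
  let g : P1 := ⟨a, by
    rw [growth_iff_positive]
    intro m N
    obtain ⟨n, hn, hn', hc⟩ := h5 (max m N) (s (max m N))
    refine ⟨n, (le_max_right m N).trans ((hid _).trans hn), ?_⟩
    refine le_trans ?_ (hc.trans (Set.encard_le_encard ?_))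
    · exact_mod_cast le_max_left m N
    · rintro j ⟨hj, hjf⟩
      refine ⟨hj, ?_⟩
      have hlt : j < (s (max m N + 1)).2 := by rw [hs, ← hn']; exact hj.2
      have := ha (max m N + 1) j hlt
      simp only [Set.mem_compl_iff, pdom, Set.mem_ofPred_eq, not_not]
      rw [this]
      exact not_mem_dom.1 hjf⟩
  have hg : ∀ k, (s k).1.1.Sub g := by
    intro k j hj
    have h := hsub k (max k (j + 1)) (le_max_left _ _) j hj
    rw [← h]
    exact ha _ j (lt_of_lt_of_le (Nat.lt_succ_self j) ((le_max_right _ _).trans (hid _)))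
  exact ⟨g, hg 0, fun k => (s k).2, hM, fun k => hmono _ _ _ (hg (k + 1)) (h3 k (s k))⟩

/-- If densely many conditions decide each `i`, then below any condition there is one that decides
all values continuously. -/
theorem exists_continuous_reading (Dec : P1 → ℕ → ℕ → Prop)
    (hmono : ∀ f g i j, f.Sub g → Dec f i j → Dec g i j) (f₀ : P1)
    (hdense : ∀ f, AlmostSub f₀ f → ∀ i, ∃ g, f.Sub g ∧ ∃ j, Dec g i j) :
    ∃ g, f₀.Sub g ∧ ∃ (N : ℕ → ℕ) (H : (ℕ → Fin 2) → ℕ → ℕ),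
      (∀ x i, Dec (fill (N i) x g) i (H x i)) ∧
      ∀ i x x', (∀ j < N i, x j = x' j) → H x i = H x' i := by
  have key : ∀ M f, f₀.Sub f → ∃ g : P1, f.Sub g ∧ (∀ j < M, g.val j = f.val j) ∧
      ∀ x, ∀ i < M, ∃ j, Dec (fill M x g) i j := by
    intro M f hf
    let ext : (Fin M → Fin 2) → ℕ → Fin 2 := fun x j => if h : j < M then x ⟨j, h⟩ else 0
    -- The finitely many pairs (x, i) are treated one at a time: the filled condition is extended to
    -- decide i, then the values of g below M are restored.
    have fin : ∀ S : Finset ((Fin M → Fin 2) × Fin M), ∃ g : P1, f.Sub g ∧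
        (∀ j < M, g.val j = f.val j) ∧ ∀ s ∈ S, ∃ j, Dec (fill M (ext s.1) g) s.2 j := by
      intro S
      induction S using Finset.induction_on with
      | empty => exact ⟨f, Sub.refl f, fun _ _ => rfl, by simp⟩
      | insert s S _ ih =>
        obtain ⟨g, hfg, hlow, hS⟩ := ih
        -- Filling may overwrite values of f₀, so only ⊆* survives; hence the form of `hdense`.
        have hfo : AlmostSub f₀ (fill M (ext s.1) g) :=
          (hf.trans hfg).almostSub.trans (almostEq_splice _ _ _).symm.almostSub
        obtain ⟨r, hr, j, hj⟩ := hdense _ hfo s.2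
        have hgr : ∀ l, M ≤ l → l ∈ g.dom → r.val l = g.val l := fun l hl hlg => by
          have := hr l (by rw [mem_dom, fill_of_le hl]; exact hlg)
          rwa [fill_of_le hl] at this
        have hg' : g.Sub (splice M g.val r) := fun l hl => by
          rcases lt_or_ge l M with hlt | hge
          · exact splice_of_lt hlt _ _
          · rw [splice_of_le hge]; exact hgr l hge hl
        refine ⟨splice M g.val r, hfg.trans hg', fun l hl => (splice_of_lt hl _ _).trans (hlow l hl),
          fun t ht => ?_⟩
        rcases Finset.mem_insert.1 ht with rfl | ht
        · refine ⟨j, hmono r _ _ _ (fun l hl => ?_) hj⟩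
          rcases lt_or_ge l M with hlt | hge
          · have := hr l (by rw [mem_dom, fill_of_lt hlt]; simp)
            rw [this, fill_of_lt hlt, fill_of_lt hlt]
          · rw [fill_of_le hge, splice_of_le hge]
        · obtain ⟨j', hj'⟩ := hS t ht
          exact ⟨j', hmono _ _ _ _ (hg'.fill_mono M _) hj'⟩
    obtain ⟨g, hfg, hlow, hS⟩ := fin Finset.univ
    refine ⟨g, hfg, hlow, fun x i hi => ?_⟩
    obtain ⟨j, hj⟩ := hS (fun l => x l, ⟨i, hi⟩) (Finset.mem_univ _)
    refine ⟨j, ?_⟩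
    rwa [fill_congr (x' := x) (fun l hl => by simp [ext, hl])] at hj
  obtain ⟨g, hfg, M, hM, hdec⟩ := exists_fusion (fun M g => ∀ x, ∀ i < M, ∃ j, Dec (fill M x g) i j)
    (fun M f g hfg h x i hi => (h x i hi).imp fun j hj => hmono _ _ _ _ (hfg.fill_mono M x) hj)
    f₀ key
  have hlt : ∀ i, i < M (i + 1) := fun i => hM.le_apply
  -- The value is chosen from the filled condition rather than from x, so points agreeing below `M
  -- (i + 1)` receive the same value. The 0 is a default for conditions not of this form.
  have hex : ∀ i (f : P1), ∃ j, (∃ x, f = fill (M (i + 1)) x g) → Dec f i j := by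
    intro i f
    by_cases h : ∃ x, f = fill (M (i + 1)) x g
    · obtain ⟨x, rfl⟩ := h
      obtain ⟨j, hj⟩ := hdec (i + 1) x i (hlt i)
      exact ⟨j, fun _ => hj⟩
    · exact ⟨0, fun h' => absurd h' h⟩
  choose d hd using hex
  refine ⟨g, hfg, fun i => M (i + 1), fun x i => d i (fill (M (i + 1)) x g),
    fun x i => hd i _ ⟨x, rfl⟩, fun i x x' h => ?_⟩
  show d i _ = d i _
  rw [fill_congr h]

end P1

/-! ### Mimicking coordinates -/

/-- Some point of a large product is, on each line through it, not the only point of its colour. -/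
theorem exists_not_unique_on_lines {D Q : ℕ} {P : Type*} [Fintype P]
    (c : Fin (D + 1) → (Fin (D + 1) → Fin Q) → P) (hQ : (D + 1) * Fintype.card P < Q) :
    ∃ a, ∀ l, ∃ q, q ≠ a l ∧ c l (Function.update a l q) = c l a := by
  classical
  by_contra! hcon
  choose l hl using hcon
  -- If each point were alone in its colour on some line, then the direction, the colour and the
  -- remaining coordinates would determine it, leaving at most (D+1)·|P|·Q^D points.
  have hinj : Function.Injective fun a : Fin (D + 1) → Fin Q =>
      (l a, c (l a) a, fun j : Fin D => a ((l a).succAbove j)) := by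
    intro a b hab
    simp only [Prod.mk.injEq] at hab
    obtain ⟨h1, h2, h3⟩ := hab
    have hupd : Function.update a (l a) (b (l a)) = b := by
      funext j
      rcases eq_or_ne j (l a) with rfl | hj
      · simp
      · rw [Function.update_of_ne hj]
        obtain ⟨k, rfl⟩ := Fin.exists_succAbove_eq hj
        have := congrFun h3 k
        rw [← h1] at this
        exact this
    by_contra hne
    have hq : b (l a) ≠ a (l a) := fun h => hne (by rw [h, Function.update_eq_self] at hupd; exact hupd)
    refine hl a _ hq ?_
    rw [hupd, h2, h1]
  have hcard := Fintype.card_le_of_injective _ hinj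
  simp only [Fintype.card_prod, Fintype.card_fun, Fintype.card_fin] at hcard
  have hpos : 0 < Q ^ D := pow_pos (by omega) _
  have : (D + 1) * Fintype.card P * Q ^ D < Q * Q ^ D := Nat.mul_lt_mul_of_pos_right hQ hpos
  rw [pow_succ'] at hcard
  nlinarith

/-- Given a finite set `F` of coordinates, every large set contains a set `V` of prescribed size
each of whose elements is mimicked by an element outside `V`, with respect to the points that
vanish off `F ∪ V` relative to `y`. -/
theorem exists_finite_mimic (H : (ℕ → Fin 2) → ℕ → ℕ) (y : ℕ → Fin 2) (F : Finset ℕ) (D : ℕ) :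
    ∃ B : ℕ, ∀ K : Set ℕ, (∀ j ∈ K, y j = 0) → Disjoint (F : Set ℕ) K → (B : ℕ∞) ≤ K.encard →
      ∃ V : Finset ℕ, (V : Set ℕ) ⊆ K ∧ V.card = D + 1 ∧ ∀ i ∈ V, ∃ i' ∈ K, i' ∉ V ∧
        ∀ x x' : ℕ → Fin 2, (∀ j, j ∉ F → j ∉ V → x j = y j) → (∀ j, j ∉ F → j ∉ V → x' j = y j) →
          x i = 0 → x' i = 0 → H x i' = H x' i' → H x i = H x' i := by
  classical
  -- A pattern gives the values on F and on the D + 1 chosen points, one from each of D + 1 groups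
  -- of size Q. A colour is a binary relation on patterns.
  let Pt := (F → Fin 2) × (Fin (D + 1) → Fin 2)
  let P := Set (Pt × Pt)
  let Q := (D + 1) * Fintype.card P + 1
  refine ⟨(D + 1) * Q, fun K hK hFK hB => ?_⟩
  obtain ⟨T, hTK, hT⟩ := Set.exists_subset_encard_eq hB
  have hTf : T.Finite := Set.finite_of_encard_eq_coe hT
  obtain ⟨e⟩ : Nonempty (Fin (D + 1) × Fin Q ≃ T) := by
    have := hTf.fintype
    refine Fintype.card_eq.1 ?_
    rw [Fintype.card_prod, Fintype.card_fin, Fintype.card_fin]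
    rw [Set.encard_eq_coe_toFinset_card] at hT
    rw [← Set.toFinset_card]
    exact_mod_cast hT.symm
  let κ : Fin (D + 1) → Fin Q → ℕ := fun l q => e (l, q)
  have hκ : ∀ l q l' q', κ l q = κ l' q' → l = l' ∧ q = q' := by
    intro l q l' q' h
    have := e.injective (Subtype.ext h)
    simpa using this
  have hκK : ∀ l q, κ l q ∈ K := fun l q => hTK (e (l, q)).2
  have hκF : ∀ l q, κ l q ∉ F := fun l q h => Set.disjoint_left.1 hFK h (hκK l q)
  -- the point with coordinates `p` on `F ∪ {κ l (a l)}`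
  let pt : (Fin (D + 1) → Fin Q) → Pt → ℕ → Fin 2 := fun a p j =>
    if h : j ∈ F then p.1 ⟨j, h⟩ else if h : ∃ l, κ l (a l) = j then p.2 h.choose else y j
  have pt_F : ∀ a p j (h : j ∈ F), pt a p j = p.1 ⟨j, h⟩ := fun a p j h => dif_pos h
  have pt_κ : ∀ a p l, pt a p (κ l (a l)) = p.2 l := by
    intro a p l
    have h : ∃ l', κ l' (a l') = κ l (a l) := ⟨l, rfl⟩
    have e1 : pt a p (κ l (a l)) = p.2 h.choose := by
      simp only [pt]
      rw [dif_neg (hκF _ _), dif_pos h]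
    rw [e1, (hκ _ _ _ _ h.choose_spec).1]
  have pt_off : ∀ a p j, j ∉ F → (∀ l, κ l (a l) ≠ j) → pt a p j = y j := by
    intro a p j hj h
    simp only [pt]
    rw [dif_neg hj, dif_neg (not_exists.2 h)]
  -- Since y vanishes on K, exchanging the l-th chosen point changes nothing when its value is 0.
  -- This is why mimicking is claimed only for x i = 0.
  have pt_update : ∀ a p l q, p.2 l = 0 → pt (Function.update a l q) p = pt a p := by
    intro a p l q hp
    have main : ∀ a b : Fin (D + 1) → Fin Q, (∀ l', l' ≠ l → a l' = b l') → ∀ j, j ∉ F →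
        (∃ l', κ l' (a l') = j) → pt a p j = pt b p j := by
      rintro a b hab j hj ⟨l', rfl⟩
      rw [pt_κ]
      rcases eq_or_ne l' l with rfl | hne
      · by_cases hb : b l' = a l'
        · rw [← hb, pt_κ]
        · rw [hp, pt_off _ _ _ hj, hK _ (hκK _ _)]
          intro l'' h
          obtain ⟨rfl, h⟩ := hκ _ _ _ _ h
          exact hb h
      · rw [hab l' hne, pt_κ]
    have hupd : ∀ l', l' ≠ l → Function.update a l q l' = a l' :=
      fun l' h => Function.update_of_ne h _ _
    funext j
    by_cases hj : j ∈ F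
    · rw [pt_F _ _ _ hj, pt_F _ _ _ hj]
    by_cases h1 : ∃ l', κ l' (Function.update a l q l') = j
    · exact main _ _ hupd j hj h1
    by_cases h2 : ∃ l', κ l' (a l') = j
    · exact (main _ _ (fun l' h => (hupd l' h).symm) j hj h2).symm
    rw [pt_off _ _ _ hj (not_exists.1 h1), pt_off _ _ _ hj (not_exists.1 h2)]
  -- The colour records which patterns with l-th value 0 give equal values of H at the l-th chosen
  -- point. Another point of the same colour on the line supplies the mimic.
  let c : Fin (D + 1) → (Fin (D + 1) → Fin Q) → P := fun l a =>
    {p | p.1.2 l = 0 ∧ p.2.2 l = 0 ∧ H (pt a p.1) (κ l (a l)) = H (pt a p.2) (κ l (a l))}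
  obtain ⟨a, ha⟩ := exists_not_unique_on_lines c (Nat.lt_succ_self _)
  have hinj : Function.Injective fun l => κ l (a l) := fun l l' h => (hκ _ _ _ _ h).1
  have hmem : ∀ j, j ∈ Finset.univ.image (fun l => κ l (a l)) ↔ ∃ l, κ l (a l) = j := by simp
  refine ⟨Finset.univ.image fun l => κ l (a l), ?_, ?_, ?_⟩
  · intro j hj
    obtain ⟨l, rfl⟩ := (hmem j).1 hj
    exact hκK _ _
  · rw [Finset.card_image_of_injective _ hinj, Finset.card_fin]
  · intro i hi
    obtain ⟨l, rfl⟩ := (hmem i).1 hi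
    obtain ⟨q, hq, hc⟩ := ha l
    refine ⟨κ l q, hκK _ _, ?_, ?_⟩
    · rw [hmem]
      rintro ⟨l', h⟩
      obtain ⟨rfl, h'⟩ := hκ _ _ _ _ h
      exact hq h'.symm
    · intro x x' hx hx' hxi hxi' hH
      have hpt : ∀ z : ℕ → Fin 2, (∀ j, j ∉ F → j ∉ Finset.univ.image (fun l => κ l (a l)) →
          z j = y j) → pt a (fun j => z j, fun l => z (κ l (a l))) = z := by
        intro z hz
        funext j
        by_cases hj : j ∈ F
        · rw [pt_F _ _ _ hj]
        by_cases h : ∃ l, κ l (a l) = j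
        · obtain ⟨l, rfl⟩ := h
          rw [pt_κ]
        · rw [pt_off _ _ _ hj (not_exists.1 h), hz j hj (fun h' => h ((hmem j).1 h'))]
      have hin : ((fun j : F => x j, fun l => x (κ l (a l))),
          (fun j : F => x' j, fun l => x' (κ l (a l)))) ∈ c l (Function.update a l q) := by
        refine ⟨hxi, hxi', ?_⟩
        rw [pt_update _ _ _ _ hxi, pt_update _ _ _ _ hxi', hpt x hx, hpt x' hx',
          Function.update_self]
        exact hH
      rw [hc] at hin
      have := hin.2.2
      rwa [hpt x hx, hpt x' hx'] at this

/-- `exists_finite_mimic` is applied in later and later blocks, with the points already chosen as F.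
Each new bound dominates N on the block just used, so the values of H there do not see points chosen
later. -/
theorem Positive.exists_mimic {U : Set ℕ} (hU : Positive U) (N : ℕ → ℕ)
    (H : (ℕ → Fin 2) → ℕ → ℕ) (hH : ∀ i x x', (∀ j < N i, x j = x' j) → H x i = H x' i)
    (y : ℕ → Fin 2) (hy : ∀ j ∈ U, y j = 0) :
    ∃ U' ⊆ U, Positive U' ∧ 0 ∉ U' ∧ ∀ i ∈ U', ∃ i' ∉ U', ∀ x x' : ℕ → Fin 2,
      (∀ j ∉ U', x j = y j) → (∀ j ∉ U', x' j = y j) → x i = 0 → x' i = 0 →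
      H x i' = H x' i' → H x i = H x' i := by
  classical
  -- a stage is a finite set together with a bound for it
  have next : ∀ (k : ℕ) (s : {s : Finset ℕ × ℕ // ∀ j ∈ s.1, j < s.2}),
      ∃ t : {s : Finset ℕ × ℕ // ∀ j ∈ s.1, j < s.2}, ∃ V : Finset ℕ, ∃ n ≥ s.1.2,
        k ≤ n ∧ (V : Set ℕ) ⊆ block n ∩ U ∧ V.card = k + 1 ∧ t.1.1 = s.1.1 ∪ V ∧ s.1.2 ≤ t.1.2 ∧
        ∀ i ∈ V, ∃ i', s.1.2 ≤ i' ∧ i' < t.1.2 ∧ i' ∉ V ∧ N i ≤ t.1.2 ∧ N i' ≤ t.1.2 ∧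
          ∀ x x' : ℕ → Fin 2, (∀ j, j ∉ t.1.1 → x j = y j) → (∀ j, j ∉ t.1.1 → x' j = y j) →
          x i = 0 → x' i = 0 → H x i' = H x' i' → H x i = H x' i := by
    rintro k ⟨⟨F, M⟩, hF⟩
    obtain ⟨B, hB⟩ := exists_finite_mimic H y F k
    obtain ⟨n, hn, hc⟩ := hU B (max M k)
    have hMn : M ≤ n := (le_max_left _ _).trans hn
    obtain ⟨V, hVK, hV, hmim⟩ := hB (block n ∩ U) (fun j hj => hy j hj.2)
      (Set.disjoint_left.2 fun j hj hj' =>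
        absurd (hF j hj) (not_lt.2 (hMn.trans (le_of_mem_block hj'.1)))) hc
    let M' := (Finset.range (2 ^ (n + 1))).sup N + 2 ^ (n + 1)
    have hN : ∀ j ∈ block n, N j ≤ M' := fun j hj =>
      (Finset.le_sup (f := N) (Finset.mem_range.2 hj.2)).trans (Nat.le_add_right _ _)
    have hlt : ∀ j ∈ block n, j < M' := fun j hj => lt_of_lt_of_le hj.2 (Nat.le_add_left _ _)
    have hMM' : M ≤ M' := (hMn.trans ((Nat.le_succ n).trans Nat.lt_two_pow_self.le)).trans
      (Nat.le_add_left _ _)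
    refine ⟨⟨(F ∪ V, M'), ?_⟩, V, n, hMn, (le_max_right _ _).trans hn, hVK, hV, rfl, hMM', ?_⟩
    · intro j hj
      rcases Finset.mem_union.1 hj with hj | hj
      · exact (hF j hj).trans_le hMM'
      · exact hlt j (hVK hj).1
    · intro i hi
      obtain ⟨i', hi', hi'V, h⟩ := hmim i hi
      refine ⟨i', hMn.trans (le_of_mem_block hi'.1), hlt i' hi'.1, hi'V, hN i (hVK hi).1,
        hN i' hi'.1, fun x x' hx hx' => h x x' ?_ ?_⟩
      · exact fun j h1 h2 => hx j (by simp [h1, h2])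
      · exact fun j h1 h2 => hx' j (by simp [h1, h2])
  choose nx V n hn hkn hVU hV hunion hle hmim using next
  let s : ℕ → {s : Finset ℕ × ℕ // ∀ j ∈ s.1, j < s.2} :=
    fun k => Nat.rec ⟨(∅, 0), by simp⟩ (fun k t => nx k t) k
  have hs : ∀ k, s (k + 1) = nx k (s k) := fun k => rfl
  have hM : Monotone fun k => (s k).1.2 := monotone_nat_of_le_succ fun k => hle k (s k)
  have hFm : ∀ k l, k ≤ l → (s k).1.1 ⊆ (s l).1.1 := by
    intro k l hkl
    induction l, hkl using Nat.le_induction with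
    | base => exact subset_rfl
    | succ l _ ih =>
      rw [hs, hunion]
      exact ih.trans Finset.subset_union_left
  have hVge : ∀ k, ∀ j ∈ V k (s k), (s k).1.2 ≤ j := fun k j hj =>
    (hn k (s k)).trans (le_of_mem_block (hVU k (s k) hj).1)
  have hmem : ∀ k j, j ∈ (s k).1.1 ↔ ∃ l < k, j ∈ V l (s l) := by
    intro k
    induction k with
    | zero => intro j; simp [s]
    | succ k ih =>
      intro j
      rw [hs, hunion, Finset.mem_union, ih]
      constructor
      · rintro (⟨l, hl, h⟩ | h)
        · exact ⟨l, hl.trans (Nat.lt_succ_self k), h⟩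
        · exact ⟨k, Nat.lt_succ_self k, h⟩
      · rintro ⟨l, hl, h⟩
        rcases Nat.lt_succ_iff_lt_or_eq.1 hl with hl | rfl
        · exact Or.inl ⟨l, hl, h⟩
        · exact Or.inr h
  let U' : Set ℕ := {j | ∃ k, j ∈ V k (s k)}
  have hbelow : ∀ k j, j ∈ U' → j < (s k).1.2 → j ∈ (s k).1.1 := by
    rintro k j ⟨l, hl⟩ hj
    refine (hmem k j).2 ⟨l, ?_, hl⟩
    by_contra hkl
    exact absurd ((hM (not_lt.1 hkl)).trans (hVge l j hl)) (not_le.2 hj)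
  refine ⟨U', ?_, ?_, ?_, ?_⟩
  · rintro j ⟨k, hk⟩
    exact (hVU k (s k) hk).2
  · intro m L
    let k := max m L
    refine ⟨n k (s k), (le_max_right m L).trans (hkn k (s k)), ?_⟩
    have hsub : (V k (s k) : Set ℕ) ⊆ block (n k (s k)) ∩ U' := fun j hj =>
      ⟨(hVU k (s k) hj).1, k, hj⟩
    refine le_trans ?_ (Set.encard_le_encard hsub)
    rw [Set.encard_coe_eq_coe_finsetCard, hV]
    exact_mod_cast (le_max_left m L).trans (Nat.le_succ _)
  · rintro ⟨k, hk⟩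
    have h : 0 < 2 ^ n k (s k) := pow_pos (by norm_num) _
    exact absurd (hVU k (s k) hk).1.1 (not_le.2 h)
  · rintro i ⟨k, hk⟩
    obtain ⟨i', h1, h2, h3, h4, h5, h6⟩ := hmim k (s k) i hk
    rw [← hs] at h2 h4 h5 h6
    have hiF : i ∈ (s (k + 1)).1.1 := (hmem _ _).2 ⟨k, Nat.lt_succ_self k, hk⟩
    refine ⟨i', fun hi' => ?_, fun x x' hx hx' hxi hxi' hHx => ?_⟩
    · obtain ⟨l, hl, hl'⟩ := (hmem (k + 1) i').1 (hbelow (k + 1) i' hi' h2)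
      rcases Nat.lt_succ_iff_lt_or_eq.1 hl with hl | rfl
      · exact absurd ((s k).2 i' ((hmem _ _).2 ⟨l, hl, hl'⟩)) (not_lt.2 h1)
      · exact h3 hl'
    -- Off the finite stage, z is reset to y. Below the bound this changes nothing, so the values at
    -- i and i' are unaffected.
    · let tr : (ℕ → Fin 2) → ℕ → Fin 2 := fun z j => if j ∈ (s (k + 1)).1.1 then z j else y j
      have htr : ∀ z : ℕ → Fin 2, (∀ j ∉ U', z j = y j) → ∀ j < (s (k + 1)).1.2, z j = tr z j := by
        intro z hz j hj
        by_cases h : j ∈ (s (k + 1)).1.1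
        · simp [tr, h]
        · simp only [tr, h, if_false]
          exact hz j fun hjU => h (hbelow (k + 1) j hjU hj)
      have hoff : ∀ z j, j ∉ (s (k + 1)).1.1 → tr z j = y j := fun z j h => by simp [tr, h]
      have hti : ∀ z : ℕ → Fin 2, z i = 0 → tr z i = 0 := fun z h => by simp [tr, hiF, h]
      have hval : ∀ z : ℕ → Fin 2, (∀ j ∉ U', z j = y j) → ∀ l, N l ≤ (s (k + 1)).1.2 →
          H z l = H (tr z) l := fun z hz l hl =>
        hH l _ _ fun j hj => htr z hz j (hj.trans_le hl)
      rw [hval x hx i h4, hval x' hx' i h4]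
      rw [hval x hx i' h5, hval x' hx' i' h5] at hHx
      exact h6 _ _ (hoff x) (hoff x') (hti x hxi) (hti x' hxi') hHx

/-! ### The dichotomy for conditions of ℙ₁. -/

namespace P1

/-- No extension of `f` fixes the values of `H` on `dom f`. -/
def Varies (f : P1) (H : (ℕ → Fin 2) → ℕ → ℕ) : Prop :=
  ∀ r : P1, f.Sub r → ∃ i ∈ f.dom, ∃ x x', Extends x r ∧ Extends x' r ∧ H x i ≠ H x' i

/-- `f ∪ {(i, 0)}` fixes the value of `H` at `i`, for each `i ∉ dom f`. -/
def FixesAtZero (f : P1) (H : (ℕ → Fin 2) → ℕ → ℕ) : Prop :=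
  ∀ i ∉ f.dom, ∀ x x', Extends x f → Extends x' f → x i = 0 → x' i = 0 → H x i = H x' i

/-- Each undefined i has its mimic i' inside dom f. An extension r of f fixing H on dom f therefore
also fixes `H x i` among the x extending r with x i = 0, and r is the condition taken in that case.
-/
theorem exists_varies_or_fixesAtZero (Dec : P1 → ℕ → ℕ → Prop)
    (hmono : ∀ f g i j, f.Sub g → Dec f i j → Dec g i j) (f₀ : P1)
    (hdense : ∀ f, AlmostSub f₀ f → ∀ i, ∃ g, f.Sub g ∧ ∃ j, Dec g i j) :
    ∃ f, f₀.Sub f ∧ ∃ (N : ℕ → ℕ) (H : (ℕ → Fin 2) → ℕ → ℕ),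
      (∀ x i, Dec (fill (N i) x f) i (H x i)) ∧
      (f.Varies H ∨ 0 ∈ f.dom ∧ f.FixesAtZero H) := by
  obtain ⟨g, hg, N, H, hdec, hH⟩ := exists_continuous_reading Dec hmono f₀ hdense
  -- The default must be 0: mimicking needs y to vanish off dom g.
  let y : ℕ → Fin 2 := fun j => (g.val j).getD 0
  have hy : ∀ j ∈ g.domᶜ, y j = 0 := fun j hj => by simp [y, not_mem_dom.1 hj]
  obtain ⟨U, hUg, hU, h0, hmim⟩ := g.positive.exists_mimic N H hH y hy
  classical
  let f : P1 := ⟨fun j => if j ∈ U then none else some (y j), by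
    rw [growth_iff_positive]
    refine hU.of_agree 0 fun j _ hj => ?_
    simp [pdom, hj]⟩
  have hfval : ∀ j ∉ U, f.val j = some (y j) := fun j hj => if_neg hj
  have hfdom : ∀ j, j ∈ f.dom ↔ j ∉ U := by
    intro j
    by_cases hj : j ∈ U
    · simp [mem_dom, f, hj]
    · simp [mem_dom, hfval j hj, hj]
  have hgf : g.Sub f := by
    intro j hj
    rw [hfval j fun h => hUg h hj]
    obtain ⟨b, hb⟩ := Option.ne_none_iff_exists'.1 (mem_dom.1 hj)
    simp [y, hb]
  have hfdec : ∀ r : P1, f.Sub r → ∀ x i, Dec (fill (N i) x r) i (H x i) := fun r hr x i =>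
    hmono _ _ _ _ ((hgf.trans hr).fill_mono _ _) (hdec x i)
  by_cases hv : f.Varies H
  · exact ⟨f, hg.trans hgf, N, H, hfdec f (Sub.refl f), Or.inl hv⟩
  · simp only [Varies, not_forall, not_exists, not_and, not_not] at hv
    obtain ⟨r, hr, hconst⟩ := hv
    refine ⟨r, hg.trans (hgf.trans hr), N, H, hfdec r hr, Or.inr ⟨?_, ?_⟩⟩
    · exact hr.dom_subset ((hfdom 0).2 h0)
    · intro i hi x x' hx hx' hxi hxi'
      have hiU : i ∈ U := by
        by_contra h
        exact hi (hr.dom_subset ((hfdom i).2 h))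
      obtain ⟨i', hi', h⟩ := hmim i hiU
      have hoff : ∀ z, Extends z r → ∀ j ∉ U, z j = y j := fun z hz j hj => by
        have := (hz.mono hr) j ((hfdom j).2 hj)
        rw [hfval j hj] at this
        exact (Option.some.inj this).symm
      exact h x x' (hoff x hx) (hoff x' hx') hxi hxi'
        (hconst i' ((hfdom i').2 hi') x x' hx hx')

end P1

/-! ### Countably closed forcing -/

section Forcing

variable {C : Type u} [Preorder C]

theorem DenseBelow.mono {D : Set C} {p q : C} (h : DenseBelow D p) (hq : q ≤ p) :
    DenseBelow D q := fun r hr => h r (hr.trans hq)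

theorem DenseBelow.of_dense {D : Set C} {p : C} (h : ∀ q ≤ p, ∃ r ≤ q, DenseBelow D r) :
    DenseBelow D p := fun q hq =>
  let ⟨r, hr, hD⟩ := h q hq
  let ⟨t, ht, htD⟩ := hD r le_rfl
  ⟨t, ht.trans hr, htD⟩

theorem DenseBelow.of_forall_mem {D : Set C} {p : C} (h : ∀ q ≤ p, q ∈ D) : DenseBelow D p :=
  fun q hq => ⟨q, le_rfl, h q hq⟩

/-- Every descending sequence of conditions has a lower bound. -/
def SigmaClosed (C : Type u) [Preorder C] : Prop :=
  ∀ s : ℕ → C, Antitone s → ∃ c, ∀ n, c ≤ s n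

/-- This is how countably many facts about names are decided by a single condition. -/
theorem SigmaClosed.exists_mem_forall (hC : SigmaClosed C) {ι : Type*} [Countable ι]
    {D : ι → Set C} (hopen : ∀ i q r, r ≤ q → q ∈ D i → r ∈ D i) {p : C}
    (hdense : ∀ i, DenseBelow (D i) p) : ∃ q ≤ p, ∀ i, q ∈ D i := by
  rcases isEmpty_or_nonempty ι with hι | hι
  · exact ⟨p, le_rfl, fun i => hι.elim i⟩
  obtain ⟨e, he⟩ := exists_surjective_nat ι
  have next : ∀ (n : ℕ) (s : {q : C // q ≤ p}), ∃ t : {q : C // q ≤ p}, t.1 ≤ s.1 ∧ t.1 ∈ D (e n) := by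
    rintro n ⟨q, hq⟩
    obtain ⟨r, hr, hD⟩ := hdense (e n) q hq
    exact ⟨⟨r, hr.trans hq⟩, hr, hD⟩
  choose nx h1 h2 using next
  let s : ℕ → {q : C // q ≤ p} := fun n => Nat.rec ⟨p, le_rfl⟩ (fun n t => nx n t) n
  obtain ⟨c, hc⟩ := hC (fun n => (s n).1) (antitone_nat_of_succ_le fun n => h1 n (s n))
  refine ⟨c, hc 0, fun i => ?_⟩
  obtain ⟨n, rfl⟩ := he i
  exact hopen _ _ _ (hc (n + 1)) (h2 n (s n))

end Forcing

theorem Collapse.sigmaClosed : SigmaClosed Collapse := by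
  intro s hs
  have hlen : ∀ n m, n ≤ m → (s n).len ≤ (s m).len := fun n m h => (hs h).1
  have hval : ∀ n m (ξ : Ordinal) (hn : ξ < (s n).len) (hm : ξ < (s m).len),
      (s n).val ⟨ξ, hn⟩ = (s m).val ⟨ξ, hm⟩ := by
    intro n m ξ hn hm
    rcases le_total n m with h | h
    · exact ((hs h).2 ⟨ξ, hn⟩).symm
    · exact (hs h).2 ⟨ξ, hm⟩
  have hex : ∀ ξ : Set.Iio (⨆ n, (s n).len), ∃ n, ξ.1 < (s n).len := fun ξ =>
    Ordinal.lt_iSup_iff.1 ξ.2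
  refine ⟨⟨⨆ n, (s n).len, Ordinal.iSup_lt_omega_one fun n => (s n).len_lt,
    fun ξ => (s (hex ξ).choose).val ⟨ξ.1, (hex ξ).choose_spec⟩⟩, fun n => ?_⟩
  exact ⟨Ordinal.le_iSup (fun n => (s n).len) n, fun ξ => hval _ _ _ _ _⟩

/-! ### The poset `ℙ(𝔉)` -/

open Sentence

section PF

variable {C : Type u} [Preorder C] {μ : Ordinal.{v}} {F : Name C (Set.Iio μ × P1)}
  {h : Name C (ℕ × ℕ × P1)}

theorem inPF_of_inF {f : P1} {p : C} (hf : inF F f p) : inPF F f p :=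
  DenseBelow.of_forall_mem fun _ hq => ⟨f, DenseBelow.mono hf hq, P1.AlmostEq.refl f⟩

theorem inPF_mono {f : P1} {p q : C} (hf : inPF F f p) (hq : q ≤ p) : inPF F f q :=
  DenseBelow.mono hf hq

theorem inPF_of_almostEq {f g : P1} {p : C} (hf : inPF F f p) (hgf : P1.AlmostEq g f) :
    inPF F g p := fun q hq =>
  let ⟨r, hr, k, hk, hfk⟩ := hf q hq
  ⟨r, hr, k, hk, hgf.trans hfk⟩

theorem extPF_mono {r g : P1} {p q : C} (hr : extPF F r g p) (hq : q ≤ p) : extPF F r g q :=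
  ⟨inPF_mono hr.1 hq, hr.2⟩

theorem forcesValue_mono {g : P1} {i j : ℕ} {p q : C} (hg : forcesValue F h g i j p)
    (hq : q ≤ p) : forcesValue F h g i j q := fun r c hc => hg r c (hc.trans hq)

theorem forcesValue_of_sub {f g : P1} {i j : ℕ} {p : C} (hf : forcesValue F h f i j p)
    (hfg : f.Sub g) : forcesValue F h g i j p := fun r c hc hr =>
  hf r c hc ⟨hr.1, hfg.trans hr.2⟩

/-- Once the indices of representatives in 𝔉 are decided, whichever of f and g has the later index
serves as k. -/
theorem isDescendingSeq.exists_common {f g : P1} {p : C} (hF : isDescendingSeq F p)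
    (hf : inPF F f p) (hg : inPF F g p) :
    ∃ q ≤ p, ∃ k, inPF F k q ∧ P1.AlmostSub f k ∧ P1.AlmostSub g k := by
  obtain ⟨-, hfun, hdesc⟩ := hF
  obtain ⟨p₁, hp₁, f', hf', hff'⟩ := hf p le_rfl
  obtain ⟨p₂, hp₂, g', hg', hgg'⟩ := hg p₁ hp₁
  obtain ⟨p₃, hp₃, ξ, hξ⟩ := hf' p₂ hp₂
  obtain ⟨p₄, hp₄, η, hη⟩ := hg' p₃ hp₃
  have hξ' : mem (ξ, f') F p₄ := DenseBelow.mono hξ hp₄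
  have hle : p₄ ≤ p := hp₄.trans (hp₃.trans (hp₂.trans hp₁))
  replace hf := inPF_mono hf hle
  replace hg := inPF_mono hg hle
  rcases lt_trichotomy ξ η with hlt | rfl | hlt
  · have : P1.AlmostSub f' g' := hdesc ξ η f' g' p₄ hle ⟨hlt, hξ', hη⟩
    exact ⟨p₄, hle, g, hg, hff'.almostSub.trans (this.trans hgg'.symm.almostSub),
      (P1.AlmostEq.refl g).almostSub⟩
  · have : f' = g' := hfun ξ f' g' p₄ hle ⟨hξ', hη⟩
    subst this
    exact ⟨p₄, hle, g, hg, (hff'.trans hgg'.symm).almostSub, (P1.AlmostEq.refl g).almostSub⟩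
  · have : P1.AlmostSub g' f' := hdesc η ξ g' f' p₄ hle ⟨hlt, hη, hξ'⟩
    exact ⟨p₄, hle, f, hf, (P1.AlmostEq.refl f).almostSub,
      hgg'.almostSub.trans (this.trans hff'.symm.almostSub)⟩

/-! ### Reading ℙ(𝔉)-names in the ground model. -/

/-- `g` and `g'` are compatible in `ℙ(𝔉)`. -/
def compatPF (F : Name C (Set.Iio μ × P1)) (g g' : P1) : Sentence C :=
  ex fun r : P1 => extPF F r g ⋏ extPF F r g'

/-- A name for a maximal antichain inside a dense set of conditions, given by a predicate that is
preserved by strengthening. -/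
theorem exists_maximal_antichain_name {p : C} (Δ : P1 → C → Prop)
    (hmono : ∀ g c c', c' ≤ c → Δ g c → Δ g c')
    (hpf : ∀ g c, Δ g c → inPF F g c)
    (hdense : ∀ c ≤ p, ∀ g, inPF F g c → ∃ c' ≤ c, ∃ r, extPF F r g c' ∧ Δ r c') :
    ∃ A : Name C P1, (∀ c ≤ p, ∀ g, mem g A c → DenseBelow {d | Δ g d} c) ∧
      (∀ g g' c, mem g A c → mem g' A c → g ≠ g' → ∀ d ≤ c, ¬ compatPF F g g' d) ∧
      ∀ c ≤ p, ∀ g, inPF F g c → ∃ c' ≤ c, ∃ a, mem a A c' ∧ compatPF F a g c' := by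
  -- Zorn's lemma is applied in the ground model, to the names themselves.
  let S : Set (Set (P1 × C)) := {A | (∀ x ∈ A, Δ x.1 x.2) ∧
    ∀ x ∈ A, ∀ y ∈ A, x.1 ≠ y.1 → ∀ d, d ≤ x.2 → d ≤ y.2 → ¬ compatPF F x.1 y.1 d}
  obtain ⟨A, hA⟩ := zorn_subset S fun c hcS hc => by
    refine ⟨⋃₀ c, ⟨?_, ?_⟩, fun s hs => Set.subset_sUnion_of_mem hs⟩
    · rintro x ⟨s, hs, hx⟩
      exact (hcS hs).1 x hx
    · rintro x ⟨s, hs, hx⟩ y ⟨t, ht, hy⟩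
      rcases hc.total hs ht with hst | hts
      · exact (hcS ht).2 x (hst hx) y hy
      · exact (hcS hs).2 x hx y (hts hy)
  refine ⟨A, ?_, ?_, ?_⟩
  · intro c _ g hg d hd
    obtain ⟨e, he, e₀, heA, hee₀⟩ := hg d hd
    exact ⟨e, he, hmono _ _ _ hee₀ (hA.prop.1 _ heA)⟩
  · intro g g' c hg hg' hne d hd hcompat
    obtain ⟨e, he, e₀, heA, hee₀⟩ := hg d hd
    obtain ⟨e', he', e₀', heA', hee₀'⟩ := hg' e (he.trans hd)
    exact hA.prop.2 _ heA _ heA' hne e' (he'.trans hee₀) hee₀'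
      (DenseBelow.mono hcompat (he'.trans he))
  · intro c hc g hg
    by_contra! hcon
    -- If g were incompatible with the whole antichain below c, an extension r satisfying Δ could be
    -- adjoined to the name.
    obtain ⟨c', hc', r, hr, hrΔ⟩ := hdense c hc g hg
    have hcompat : ∀ a d, d ≤ c' → compatPF F a r d → compatPF F a g d := by
      intro a d hd had e he
      obtain ⟨e', he', t, hta, htr⟩ := had e he
      exact ⟨e', he', t, hta, htr.1, hr.2.trans htr.2⟩
    have hmem : ∀ x ∈ A, ∀ d, d ≤ x.2 → mem x.1 (show Name C P1 from A) d := fun x hx d hd =>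
      DenseBelow.of_forall_mem fun e he => ⟨x.2, hx, he.trans hd⟩
    have hno : ∀ x ∈ A, ∀ d, d ≤ x.2 → d ≤ c' → ¬ compatPF F x.1 r d := fun x hx d hd hdc hcomp =>
      hcon d (hdc.trans hc') x.1 (hmem x hx d hd) (hcompat _ _ hdc hcomp)
    have hsymm : ∀ a b d, compatPF F a b d → compatPF F b a d := fun a b d hab e he =>
      let ⟨e', he', t, h1, h2⟩ := hab e he
      ⟨e', he', t, h2, h1⟩
    have hins : insert (r, c') A ∈ S := by
      refine ⟨?_, ?_⟩
      · rintro x (rfl | hx)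
        · exact hrΔ
        · exact hA.prop.1 x hx
      · rintro x (rfl | hx) y (rfl | hy) hne d hdx hdy hcomp
        · exact hne rfl
        · exact hno y hy d hdy hdx (hsymm _ _ _ hcomp)
        · exact hno x hx d hdx hdy hcomp
        · exact hA.prop.2 x hx y hy hne d hdx hdy hcomp
    have hrA : (r, c') ∈ A := hA.le_of_ge hins (Set.subset_insert _ _) (Set.mem_insert _ _)
    refine hno _ hrA c' le_rfl le_rfl (DenseBelow.of_forall_mem fun e he => ⟨r, ?_, ?_⟩) <;>
    exact ⟨inPF_mono (hpf _ _ hrΔ) he, P1.Sub.refl r⟩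

/-- By ccc and countable closure, a `ℙ(𝔉)`-name for a function is read, below some condition, from
ground model sets of conditions deciding its values. -/
theorem exists_ground_reading (hC : SigmaClosed C) {p : C} (hccc : isCCC F p)
    (hname : isFunctionName F h p) :
    ∃ q ≤ p, ∃ A : ℕ → ℕ → Set P1,
      (∀ i j, ∀ a ∈ A i j, forcesValue F h a i j q) ∧
      ∀ c ≤ q, ∀ r, inPF F r c → ∀ i, ∃ c' ≤ c, ∃ s, extPF F s r c' ∧
        ∃ j, ∃ a ∈ A i j, a.Sub s := by
  obtain ⟨-, hdec, -⟩ := hname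
  let Δ : ℕ → P1 → C → Prop := fun i g c => inPF F g c ∧ ∃ j, forcesValue F h g i j c
  have hmono : ∀ i g c c', c' ≤ c → Δ i g c → Δ i g c' := fun i g c c' hc hg =>
    ⟨inPF_mono hg.1 hc, hg.2.imp fun j hj => forcesValue_mono hj hc⟩
  have hmax := fun i => exists_maximal_antichain_name (F := F) (p := p) (Δ i) (hmono i)
    (fun g c hg => hg.1) fun c hc g hg => by
      obtain ⟨c', hc', r, hr, hj⟩ := hdec i g c hc hg c le_rfl
      obtain ⟨c'', hc'', j, hj⟩ := hj c' le_rfl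
      exact ⟨c'', hc''.trans hc', r, extPF_mono hr hc'', hr.1.mono hc'', j, hj⟩
  choose A hAΔ hAanti hAmax using hmax
  have hAPF : ∀ i, ∀ c ≤ p, ∀ g, mem g (A i) c → inPF F g c := fun i c hc g hg =>
    DenseBelow.of_dense fun d hd =>
      let ⟨e, he, hΔ⟩ := hAΔ i c hc g hg d hd
      ⟨e, he, hΔ.1⟩
  have hccc' : ∀ i, DenseBelow {q | ∃ e : Name C (ℕ × P1),
      ((all fun n : ℕ => all fun g : P1 => all fun g' : P1 =>
        mem (n, g) e ⋏ mem (n, g') e ⟹ ground (g = g')) ⋏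
      (all fun g : P1 => mem g (A i) ⟹ ex fun n : ℕ => mem (n, g) e)) q} p := by
    intro i
    refine hccc (A i) p le_rfl ⟨fun g c hc hg => hAPF i c hc g hg, ?_⟩
    rintro g g' c hc ⟨hg, hg', hne⟩ d hd
    exact hAanti i g g' c hg hg' hne d hd
  obtain ⟨q₁, hq₁, he⟩ := hC.exists_mem_forall
    (fun i q r hr => by
      rintro ⟨e, h1, h2⟩
      exact ⟨e, fun n g g' c hc => h1 n g g' c (hc.trans hr), fun g c hc => h2 g c (hc.trans hr)⟩)
    hccc'
  choose e hefun hecov using he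
  -- For each (i, n), q decides the n-th element of the i-th antichain and a value forced by it, or
  -- excludes that any element of the antichain has index n.
  obtain ⟨q, hq, hval⟩ := hC.exists_mem_forall (ι := ℕ × ℕ) (p := q₁)
    (D := fun x => {c | (∃ g j, mem (x.2, g) (e x.1) c ∧ forcesValue F h g x.1 j c) ∨
      ∀ g, ∀ d ≤ c, ¬ (mem (x.2, g) (e x.1) ⋏ mem g (A x.1)) d})
    (by
      rintro ⟨i, n⟩ c d hd (⟨g, j, hg, hj⟩ | hno)
      · exact Or.inl ⟨g, j, DenseBelow.mono hg hd, forcesValue_mono hj hd⟩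
      · exact Or.inr fun g d' hd' => hno g d' (hd'.trans hd))
    (by
      rintro ⟨i, n⟩ c hc
      by_cases hex : ∃ g, ∃ d ≤ c, (mem (n, g) (e i) ⋏ mem g (A i)) d
      · obtain ⟨g, d, hd, hg, hgA⟩ := hex
        obtain ⟨d', hd', -, j, hj⟩ := hAΔ i d (hd.trans (hc.trans hq₁)) g hgA d le_rfl
        exact ⟨d', hd'.trans hd, Or.inl ⟨g, j, DenseBelow.mono hg hd', hj⟩⟩
      · push Not at hex
        exact ⟨c, le_rfl, Or.inr hex⟩)
  refine ⟨q, hq.trans hq₁, fun i j => {a | forcesValue F h a i j q}, fun i j a ha => ha,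
    fun c hc r hr i => ?_⟩
  obtain ⟨c₁, hc₁, a, haA, har⟩ := hAmax i c (hc.trans (hq.trans hq₁)) r hr
  obtain ⟨c₂, hc₂, n, hn⟩ := hecov i a c₁ (hc₁.trans (hc.trans hq)) haA c₁ le_rfl
  obtain ⟨c₃, hc₃, s, hsa, hsr⟩ := har c₂ hc₂
  have hc₃q : c₃ ≤ q := hc₃.trans (hc₂.trans (hc₁.trans hc))
  have hn₃ : mem (n, a) (e i) c₃ := DenseBelow.mono hn hc₃
  refine ⟨c₃, hc₃.trans (hc₂.trans hc₁), s, hsr, ?_⟩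
  rcases hval (i, n) with ⟨g, j, hg, hj⟩ | hno
  · have : g = a := hefun i n g a c₃ (hc₃q.trans hq) ⟨DenseBelow.mono hg hc₃q, hn₃⟩
    subst this
    exact ⟨j, g, hj, hsa.2⟩
  · exact absurd ⟨hn₃, DenseBelow.mono haA (hc₃.trans hc₂)⟩ (hno a c₃ hc₃q)

/-! ### From the dichotomy to the two alternatives. -/

/-- If no extension of `f` fixes the values of a reading of `ḣ` on `dom f`, then `f` forces
`ḣ ↾ dom f` to be new. -/
theorem forcesRestrictionNew_of_varies {p : C} (hdesc : isDescendingSeq F p)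
    (hgen : isGenericOverGround F p) (hname : isFunctionName F h p)
    {Dec : P1 → ℕ → ℕ → Prop} (hDec : ∀ g i j, Dec g i j → forcesValue F h g i j p)
    (hmono : ∀ f g i j, f.Sub g → Dec f i j → Dec g i j)
    {f : P1} {N : ℕ → ℕ} {H : (ℕ → Fin 2) → ℕ → ℕ}
    (hH : ∀ x i, Dec (P1.fill (N i) x f) i (H x i)) (hf : f.Varies H) :
    forcesRestrictionNew F h f p := by
  intro e r c hc hr d hd hall
  -- This set lies in V because `Dec` does. The first clause covers the t with no common
  -- almost-extension with r; it cannot occur in 𝔉, by `isDescendingSeq.exists_common`.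
  let D : Set P1 := {t | (∀ g, P1.AlmostSub t g → ¬ P1.AlmostSub r g) ∨
    (r.Sub t ∧ ∃ i ∈ f.dom, ∃ j, j ≠ e i ∧ Dec t i j)}
  have hD : P1.IsDense D := by
    intro t
    by_cases ht : ∃ g, P1.AlmostSub t g ∧ P1.AlmostSub r g
    · obtain ⟨g, htg, hrg⟩ := ht
      obtain ⟨g', hg', hrg'⟩ := hrg.exists_sub
      have hfg' : f.Sub g' := P1.Sub.trans hr.2 hrg'
      obtain ⟨i, hi, x, hx, hne⟩ : ∃ i ∈ f.dom, ∃ x, P1.Extends x g' ∧ H x i ≠ e i := by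
        obtain ⟨i, hi, x, x', hx, hx', hne⟩ := hf g' hfg'
        by_cases hxe : H x i = e i
        · exact ⟨i, hi, x', hx', fun h' => hne (hxe.trans h'.symm)⟩
        · exact ⟨i, hi, x, hx, hxe⟩
      refine ⟨P1.fill (N i) x g', Or.inr ⟨hrg'.trans (hx.sub_fill _), i, hi, H x i, hne, ?_⟩, ?_⟩
      · exact hmono _ _ _ _ (hfg'.fill_mono _ _) (hH x i)
      · exact htg.trans (hg'.symm.almostSub.trans (hx.sub_fill _).almostSub)
    · push Not at ht
      exact ⟨t, Or.inl ht, (P1.Sub.refl t).almostSub⟩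
  have hdp : d ≤ p := hd.trans hc
  obtain ⟨d', hd', t, htD, htF⟩ := hgen D d hdp hD d le_rfl
  have htPF : inPF F t d' := inPF_of_inF htF
  have hd'p : d' ≤ p := hd'.trans hdp
  rcases htD with hno | ⟨hrt, i, hi, j, hj, hdec⟩
  · obtain ⟨d'', hd'', k, -, htk, hrk⟩ := isDescendingSeq.exists_common
      (p := d') ⟨fun ξ => DenseBelow.mono (hdesc.1 ξ) hd'p,
        fun ξ f g c hc => hdesc.2.1 ξ f g c (hc.trans hd'p),
        fun ξ η f g c hc => hdesc.2.2 ξ η f g c (hc.trans hd'p)⟩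
      htPF (inPF_mono hr.1 (hd'.trans hd))
    exact hno k htk hrk
  · have h1 : forcesValue F h t i (e i) d' := forcesValue_of_sub (hall i d' hd' hi) hrt
    have h2 : forcesValue F h t i j d' := forcesValue_mono (hDec _ _ _ hdec) hd'p
    exact hj (hname.2.2 i j (e i) t d' hd'p ⟨htPF, h2, h1⟩)

/-- If `f ∪ {(i, 0)}` fixes the `i`-th value of a reading of `ḣ`, then it forces that value on
`ḣ(i)`. -/
theorem decidesOnPieces_of_fixesAtZero {p : C}
    {Dec : P1 → ℕ → ℕ → Prop} (hDec : ∀ g i j, Dec g i j → forcesValue F h g i j p)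
    (hmono : ∀ f g i j, f.Sub g → Dec f i j → Dec g i j)
    {f : P1} {N : ℕ → ℕ} {H : (ℕ → Fin 2) → ℕ → ℕ}
    (hH : ∀ x i, Dec (P1.fill (N i) x f) i (H x i)) (h0 : 0 ∈ f.dom) (hf : f.FixesAtZero H) :
    decidesOnPieces F h f id (fun k => f.domᶜ ∩ block k) p := by
  refine ⟨strictMono_id, ?_, fun k => Set.inter_subset_right, ?_⟩
  · show f.domᶜ = ⋃ k, f.domᶜ ∩ block k
    rw [← Set.inter_iUnion]
    refine (Set.inter_eq_left.2 fun i hi => ?_).symm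
    -- The blocks cover only the positive integers, hence the requirement 0 ∈ dom f.
    have hi0 : i ≠ 0 := fun h => hi (h ▸ h0)
    exact Set.mem_iUnion.2 ⟨Nat.log 2 i, Nat.pow_log_le_self 2 hi0,
      Nat.lt_pow_succ_log_self (by norm_num) i⟩
  · rintro k i c hc ⟨hi, -⟩
    have hins : ∀ r : P1, (f.insert i 0).Sub r → f.Sub r ∧ r.val i = some 0 := by
      intro r hr
      have hii : (f.insert i 0).val i = some 0 := Function.update_self _ _ _
      refine ⟨fun l hl => ?_, ?_⟩
      · have hli : l ≠ i := fun e => hi (e ▸ hl)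
        have e1 : (f.insert i 0).val l = f.val l := Function.update_of_ne hli _ _
        rw [← e1]
        exact hr l (by rw [P1.mem_dom, e1]; exact hl)
      · rw [← hii]
        exact hr i (by rw [P1.mem_dom, hii]; simp)
    have hz : ∀ (r : P1) x, (f.insert i 0).Sub r → P1.Extends x r → x i = 0 := by
      intro r x hr hx
      have h1 := (hins r hr).2
      have h2 := hx i (by rw [P1.mem_dom, h1]; simp)
      rw [h1] at h2
      exact (Option.some.inj h2).symm
    obtain ⟨x₀, hx₀⟩ := P1.exists_extends (f.insert i 0)
    refine DenseBelow.of_forall_mem fun d hd => ⟨H x₀ i, fun r b hb hr => ?_⟩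
    obtain ⟨x, hx⟩ := P1.exists_extends r
    have hfr := (hins r hr.2).1
    have heq : H x i = H x₀ i := hf i hi x x₀ (hx.mono hfr)
      (hx₀.mono (hins _ (P1.Sub.refl _)).1) (hz r x hr.2 hx) (hz _ x₀ (P1.Sub.refl _) hx₀)
    have hdec : Dec (P1.fill (N i) x r) i (H x₀ i) := by
      rw [← heq]
      exact hmono _ _ _ _ (hfr.fill_mono _ _) (hH x i)
    -- As x extends r, filling r along x gives an extension of r that differs from it finitely, so
    -- it stays in ℙ(𝔉).
    have hsub := hx.sub_fill (N i)
    intro b' hb'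
    obtain ⟨b'', hb'', s, hs, hsa⟩ := hDec _ _ _ hdec (P1.fill (N i) x r) b'
      (hb'.trans (hb.trans (hd.trans hc)))
      ⟨inPF_of_almostEq (inPF_mono hr.1 hb') (P1.almostEq_splice _ _ _), P1.Sub.refl _⟩ b' le_rfl
    exact ⟨b'', hb'', s, ⟨hs.1, hsub.trans hs.2⟩, hsa⟩

end PF

end TieForcing

/-! ### The theorem. -/

open TieForcing

theorem mainTheorem5 (p : Collapse) (μ : Ordinal.{u})
    (F : Name Collapse (Set.Iio μ × P1)) (h : Name Collapse (ℕ × ℕ × P1))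
    (hdesc : p ⊩ isDescendingSeq F)
    (hgen : p ⊩ isGenericOverGround F)
    (hccc : p ⊩ isCCC F)
    (hname : p ⊩ isFunctionName F h) :
    p ⊩ (Sentence.ex fun f : P1 => inF F f ⋏ forcesRestrictionNew F h f) ⋎
      (Sentence.ex fun f : P1 => Sentence.ex fun m : ℕ → ℕ => Sentence.ex fun S : ℕ → Set ℕ =>
        inF F f ⋏ decidesOnPieces F h f m S) := by
  intro p' hp'
  have hdesc' : ∀ q ≤ p, isDescendingSeq F q := fun q hq =>
    ⟨fun ξ => DenseBelow.mono (hdesc.1 ξ) hq,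
      fun ξ f g c hc => hdesc.2.1 ξ f g c (hc.trans hq),
      fun ξ η f g c hc => hdesc.2.2 ξ η f g c (hc.trans hq)⟩
  have hgen' : ∀ q ≤ p, isGenericOverGround F q := fun q hq D c hc => hgen D c (hc.trans hq)
  have hname' : ∀ q ≤ p, isFunctionName F h q := fun q hq =>
    ⟨fun i j a c hc => hname.1 i j a c (hc.trans hq), fun i g c hc => hname.2.1 i g c (hc.trans hq),
      fun i j j' g c hc => hname.2.2 i j j' g c (hc.trans hq)⟩
  have hccc' : isCCC F p' := fun A c hc => hccc A c (hc.trans hp')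
  obtain ⟨q, hq, A, hA, hpre⟩ := exists_ground_reading Collapse.sigmaClosed hccc' (hname' p' hp')
  let Dec : P1 → ℕ → ℕ → Prop := fun g i j => ∃ a ∈ A i j, a.Sub g
  have hmono : ∀ f g i j, f.Sub g → Dec f i j → Dec g i j := fun f g i j hfg ⟨a, ha, haf⟩ =>
    ⟨a, ha, haf.trans hfg⟩
  have hDec : ∀ g i j, Dec g i j → forcesValue F h g i j q := fun g i j ⟨a, ha, hag⟩ =>
    forcesValue_of_sub (hA i j a ha) hag
  -- The first clause is there for density: without it, some f might have almost-extensions below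
  -- which a coordinate is never decided. For f in 𝔉 it contradicts `hpre`.
  let D : Set P1 := {f | (∃ i, ∀ g, f.Sub g → ∀ j, ¬ Dec g i j) ∨
    ∃ (N : ℕ → ℕ) (H : (ℕ → Fin 2) → ℕ → ℕ), (∀ x i, Dec (P1.fill (N i) x f) i (H x i)) ∧
      (f.Varies H ∨ 0 ∈ f.dom ∧ f.FixesAtZero H)}
  have hD : P1.IsDense D := by
    intro f
    by_cases hf : ∃ g, P1.AlmostSub f g ∧ ∃ i, ∀ k, g.Sub k → ∀ j, ¬ Dec k i j
    · obtain ⟨g, hfg, hg⟩ := hf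
      exact ⟨g, Or.inl hg, hfg⟩
    · push Not at hf
      obtain ⟨g, hfg, hg⟩ := P1.exists_varies_or_fixesAtZero Dec hmono f hf
      exact ⟨g, Or.inr hg, hfg.almostSub⟩
  obtain ⟨r, hr, f, hfD, hfF⟩ := hgen' q (hq.trans hp') D q le_rfl hD q le_rfl
  have hrp : r ≤ p := hr.trans (hq.trans hp')
  have hDec' : ∀ g i j, Dec g i j → forcesValue F h g i j r := fun g i j hg =>
    forcesValue_mono (hDec g i j hg) hr
  refine ⟨r, hr.trans hq, ?_⟩
  rcases hfD with ⟨i, hbad⟩ | ⟨N, H, hH, hvar | ⟨h0, hfix⟩⟩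
  · obtain ⟨c, -, s, hs, j, a, ha, has⟩ := hpre r hr f (inPF_of_inF hfF) i
    exact absurd ⟨a, ha, has⟩ (hbad s hs.2 j)
  · have := forcesRestrictionNew_of_varies (hdesc' r hrp) (hgen' r hrp) (hname' r hrp) hDec' hmono
      hH hvar
    exact Or.inl fun c hc => ⟨c, le_rfl, f, DenseBelow.mono hfF hc,
      fun e t d hd => this e t d (hd.trans hc)⟩
  · refine Or.inr ?_
    refine DenseBelow.of_forall_mem fun c hc => ⟨f, DenseBelow.of_forall_mem fun d hd =>
      ⟨id, DenseBelow.of_forall_mem fun e he => ⟨fun k => f.domᶜ ∩ block k, ?_, ?_⟩⟩⟩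
    · exact DenseBelow.mono hfF (he.trans (hd.trans hc))
    · exact decidesOnPieces_of_fixesAtZero (fun g i j hg =>
        forcesValue_mono (hDec' g i j hg) (he.trans (hd.trans hc))) hmono hH h0 hfix
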